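/- Let $(R,\mathfrak m)$ be a Noetherian local ring, $I$ an $\mathfrak m$-primary ideal of $R$, and $M$ a finitely generated $R$-module of Krull dimension $t\ge 0$ (in particular $M\neq 0$). Write $\ell_R$ for length and, for a submodule $N\subseteq M$, put $N:_M\mathfrak m=\{x\in M:\mathfrak m x\subseteq N\}$. For submodules $N,L\subseteq M$, put $N:_R L=\{a\in R: aL\subseteq N\}$. Put $s=\max(t-1,0)$. Then there are unique integers $\mathrm e_I^0(M),\dots,\mathrm e_I^t(M)$ and $\mathrm f_I^0(M),\dots,\mathrm f_I^{s}(M)$ such that, for all $n\gg 0$, the following two lengths are finite and $$\ell_R(M/I^{n+1}M)=\sum_{i=0}^{t}(-1)^i\,\mathrm e_I^i(M)\binom{n+t-i}{t-i},\qquad \ell_R\big((I^{n+1}M:_M\mathfrak m)/I^{n+1}M\big)=\sum_{i=0}^{s}(-1)^i\,\mathrm f_I^i(M)\binom{n+s-i}{s-i}.$$ The integer $\mathrm e_I^0(M)$ is the Hilbert multiplicity and $\mathrm f_I^0(M)$ the irreducible multiplicity of $M$ with respect to $I$ (for $t=0$, $\mathrm f_I^0(M)$ is the eventual constant value of the second length).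 Moreover $\ell_R((0):_M\mathfrak m)<\infty$, and $$\mathrm f_I^0(M)\le\begin{cases}\mathrm e_I^0(M) & \text{if } t\neq 1,\\ \mathrm e_I^0(M)+\ell_R((0):_M\mathfrak m) & \text{if } t=1.\end{cases}$$ Furthermore, if $t\ge 1$ and $\mathfrak m=I^{n+1}M:_R I^nM$ for some $n\ge 0$, then equality holds in the case of this inequality that applies to $t$. -/

import Mathlib

open IsLocalRing Filter

/-- The submodule `N :_M J = {x ∈ M | J x ⊆ N}` of `M`, for a submodule `N` of `M` and an ideal
`J` of `R`. -/
def moduleColon {R M : Type*} [CommRing R] [AddCommGroup M] [Module R M]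
    (N : Submodule R M) (J : Ideal R) : Submodule R M where
  carrier := {x | ∀ a ∈ J, a • x ∈ N}
  add_mem' hx hy a ha := by
    rw [smul_add]
    exact N.add_mem (hx a ha) (hy a ha)
  zero_mem' a _ := by
    rw [smul_zero]
    exact N.zero_mem
  smul_mem' r x hx a ha := by
    rw [smul_comm]
    exact N.smul_mem r (hx a ha)

/-- The Hilbert-Samuel function `n ↦ ℓ_R(M / I^{n+1} M)`. -/
noncomputable def hilbertFunction {R : Type*} (M : Type*) [CommRing R] [AddCommGroup M]
    [Module R M] (I : Ideal R) (n : ℕ) : ℕ∞ :=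
  Module.length R (M ⧸ (I ^ (n + 1) • ⊤ : Submodule R M))

/-- The irreducibility function `n ↦ ℓ_R((I^{n+1} M :_M 𝔪) / I^{n+1} M)`. -/
noncomputable def irreducibilityFunction {R : Type*} (M : Type*) [CommRing R] [IsLocalRing R]
    [AddCommGroup M] [Module R M] (I : Ideal R) (n : ℕ) : ℕ∞ :=
  Module.length R
    (moduleColon (I ^ (n + 1) • ⊤ : Submodule R M) (maximalIdeal R) ⧸
      (I ^ (n + 1) • ⊤ : Submodule R M).submoduleOf
        (moduleColon (I ^ (n + 1) • ⊤ : Submodule R M) (maximalIdeal R)))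

/-- The integers `c 0, …, c d` are the coefficients of the length function `φ` in degree `d`:
for all `n ≫ 0` the length `φ n` is finite and
`φ n = c₀ * (n + d choose d) - c₁ * (n + d - 1 choose d - 1) + ⋯ + (-1) ^ d * c_d`. -/
def IsBinomialCoefficients (φ : ℕ → ℕ∞) (d : ℕ) (c : Fin (d + 1) → ℤ) : Prop :=
  ∀ᶠ n : ℕ in atTop, φ n ≠ ⊤ ∧
    ((φ n).toNat : ℤ) =
      ∑ i : Fin (d + 1), (-1) ^ (i : ℕ) * c i * ((n + d - i).choose (d - i) : ℤ)

/-- The coefficient `c 0` of the expansion of `φ` in degree `d` (it is unique if the expansion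
exists; the value is `0` by convention if there is none). -/
noncomputable def leadingBinomialCoefficient (φ : ℕ → ℕ∞) (d : ℕ) : ℤ :=
  open Classical in
  if h : ∃ c : Fin (d + 1) → ℤ, IsBinomialCoefficients φ d c then h.choose 0 else 0

/-- The Hilbert multiplicity `e_I^0(M)` of a module `M` of dimension `t`. -/
noncomputable def hilbertMultiplicity {R : Type*} (M : Type*) [CommRing R]
    [AddCommGroup M] [Module R M] (I : Ideal R) (t : ℕ) : ℤ :=
  leadingBinomialCoefficient (hilbertFunction M I) t

/-- The irreducible multiplicity `f_I^0(M)` of a module `M` of dimension `t`: the leading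
coefficient of the irreducibility function in degree `t - 1`. Here `t - 1` is truncated: for
`t = 0` the irreducibility function is constant for `n ≫ 0`, and `f_I^0(M)` is that constant,
namely `ℓ_R(0 :_M 𝔪)`. -/
noncomputable def irreducibleMultiplicity {R : Type*} (M : Type*) [CommRing R] [IsLocalRing R]
    [AddCommGroup M] [Module R M] (I : Ideal R) (t : ℕ) : ℤ :=
  leadingBinomialCoefficient (irreducibilityFunction M I) (t - 1)

/-!
Let `G n = I ^ n M / I ^ (n + 1) M` be the graded pieces of `M`, and let `S n ⊆ G n` be the socle
of the associated graded module in degree `n`, the part killed by `𝔪`. By Artin–Rees, for `n ≫ 0`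
the module `(I ^ (n + 1) M : 𝔪) / I ^ (n + 1) M` has length `ℓ(S n) + ℓ(0 : 𝔪)`. Both `ℓ(G n)` and
`ℓ(S n)` are eventually polynomial (Hilbert–Serre, by induction on the number of generators of `I`,
taking kernel and cokernel of multiplication by one of them), and comparison with a system of
parameters bounds their degrees by `t - 1`. The leading coefficient of `ℓ(G n)` is the Hilbert
multiplicity, so `ℓ(S n) ≤ ℓ(G n)` gives the inequality; the constant `ℓ(0 : 𝔪)` affects the leading
coefficient only when `t = 1`. If `𝔪 I ^ n M ⊆ I ^ (n + 1) M` for some `n`, then `S n = G n`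
for `n ≫ 0`, and equality holds.
-/

section RelLength

variable {R M N : Type*} [CommRing R] [AddCommGroup M] [Module R M] [AddCommGroup N] [Module R N]

/-- The length of the subquotient `B / (A ∩ B)` of a module; in all applications `A ≤ B`. -/
noncomputable def relLength (A B : Submodule R M) : ℕ∞ :=
  Module.length R (B ⧸ A.submoduleOf B)

theorem relLength_eq_length_of_surjective {P : Type*} [AddCommGroup P] [Module R P]
    {A B : Submodule R M} (φ : B →ₗ[R] P) (hφ : Function.Surjective φ)
    (hker : LinearMap.ker φ = A.submoduleOf B) : relLength A B = Module.length R P := by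
  rw [relLength, ← hker]
  exact (φ.quotKerEquivOfSurjective hφ).length_eq

theorem relLength_top (A : Submodule R M) : relLength A ⊤ = Module.length R (M ⧸ A) := by
  refine relLength_eq_length_of_surjective (A.mkQ.comp (⊤ : Submodule R M).subtype) ?_ ?_
  · exact A.mkQ_surjective.comp fun x => ⟨⟨x, trivial⟩, rfl⟩
  · rw [LinearMap.ker_comp, Submodule.ker_mkQ]
    rfl

theorem relLength_bot (B : Submodule R M) : relLength ⊥ B = Module.length R B := by
  refine relLength_eq_length_of_surjective LinearMap.id Function.surjective_id ?_
  rw [LinearMap.ker_id, Submodule.submoduleOf, Submodule.comap_bot, Submodule.ker_subtype]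

theorem relLength_eq_zero_of_le {A B : Submodule R M} (h : B ≤ A) : relLength A B = 0 := by
  rw [relLength, Submodule.submoduleOf_eq_top.mpr h, Module.length_eq_zero_iff]
  infer_instance

theorem relLength_add {A B C : Submodule R M} (hAB : A ≤ B) (hBC : B ≤ C) :
    relLength A C = relLength A B + relLength B C := by
  have hcomap : A.submoduleOf B = (A.submoduleOf C).comap (Submodule.inclusion hBC) := rfl
  have hle : A.submoduleOf C ≤ (B.submoduleOf C).comap LinearMap.id := fun x hx => hAB hx
  refine Module.length_eq_add_of_exact
    (Submodule.mapQ (A.submoduleOf B) (A.submoduleOf C) (Submodule.inclusion hBC) hcomap.le)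
    (Submodule.mapQ (A.submoduleOf C) (B.submoduleOf C) LinearMap.id hle) ?_ ?_ ?_
  · rw [← LinearMap.ker_eq_bot, Submodule.ker_mapQ, ← hcomap, Submodule.mkQ_map_self]
  · intro y
    obtain ⟨x, rfl⟩ := Submodule.mkQ_surjective _ y
    exact ⟨Submodule.Quotient.mk x, rfl⟩
  · intro y
    obtain ⟨x, rfl⟩ := Submodule.mkQ_surjective _ y
    constructor
    · intro h
      have hx : x ∈ B.submoduleOf C := (Submodule.Quotient.mk_eq_zero _).mp h
      exact ⟨Submodule.Quotient.mk ⟨x, hx⟩, rfl⟩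
    · rintro ⟨z, hz⟩
      obtain ⟨b, rfl⟩ := Submodule.mkQ_surjective _ z
      rw [← hz]
      exact (Submodule.Quotient.mk_eq_zero _).mpr b.2

theorem relLength_inf_comap (φ : M →ₗ[R] N) (A : Submodule R N) (B : Submodule R M) :
    relLength (B ⊓ A.comap φ) B = relLength A (A ⊔ B.map φ) := by
  have hmem : ∀ b : B, φ b ∈ A ⊔ B.map φ := fun b =>
    Submodule.mem_sup_right (Submodule.mem_map_of_mem b.2)
  refine relLength_eq_length_of_surjective
    ((A.submoduleOf (A ⊔ B.map φ)).mkQ.comp ((φ.comp B.subtype).codRestrict _ hmem)) ?_ ?_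
  · intro y
    obtain ⟨⟨x, hx⟩, rfl⟩ := Submodule.mkQ_surjective _ y
    obtain ⟨a, ha, _, ⟨b, hb, rfl⟩, rfl⟩ := Submodule.mem_sup.mp hx
    refine ⟨⟨b, hb⟩, (Submodule.Quotient.eq _).mpr ?_⟩
    change φ b - (a + φ b) ∈ A
    rw [sub_add_cancel_right]
    exact A.neg_mem ha
  · ext b
    rw [LinearMap.ker_comp, Submodule.ker_mkQ]
    change φ b ∈ A ↔ (b : M) ∈ B ∧ φ b ∈ A
    exact (and_iff_right b.2).symm

theorem relLength_sup (A B : Submodule R M) : relLength A (A ⊔ B) = relLength (A ⊓ B) B := by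
  have := relLength_inf_comap LinearMap.id A B
  rw [Submodule.map_id, Submodule.comap_id, inf_comm] at this
  exact this.symm

/-- `φ` induces a map `B / A → B' / A'`; the identity compares its kernel and its cokernel. -/
theorem relLength_add_relLength_sup_map {A B : Submodule R M} {A' B' : Submodule R N}
    (φ : M →ₗ[R] N) (hAB : A ≤ B) (hA'B' : A' ≤ B') (hA : A ≤ A'.comap φ) (hB : B ≤ B'.comap φ) :
    relLength A B + relLength (A' ⊔ B.map φ) B' =
      relLength A (B ⊓ A'.comap φ) + relLength A' B' := by
  rw [relLength_add (le_inf hAB hA) inf_le_left, relLength_inf_comap, add_assoc,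
    ← relLength_add le_sup_left (sup_le hA'B' (Submodule.map_le_iff_le_comap.mpr hB))]

theorem relLength_mono_right {A B C : Submodule R M} (hAB : A ≤ B) (hBC : B ≤ C) :
    relLength A B ≤ relLength A C := by
  rw [relLength_add hAB hBC]
  exact le_self_add

theorem relLength_anti_left {A B C : Submodule R M} (hAB : A ≤ B) (hBC : B ≤ C) :
    relLength B C ≤ relLength A C := by
  rw [relLength_add hAB hBC]
  exact le_add_self

end RelLength

section LeadingTerm

open fwdDiff

/-- For large arguments `f` agrees with a polynomial function of degree at most `d` whose
coefficient of degree `d` is `a / d!`; thus `a = 0` means that its degree is less than `d`. This is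
encoded by the condition that the `d`-th difference of `f` is eventually equal to `a`. -/
def HasLeadingTerm (f : ℕ → ℤ) (d : ℕ) (a : ℤ) : Prop :=
  ∀ᶠ n in atTop, (Δ_[1])^[d] f n = a

theorem hasLeadingTerm_succ_iff {f : ℕ → ℤ} {d : ℕ} {a : ℤ} :
    HasLeadingTerm f (d + 1) a ↔ HasLeadingTerm (Δ_[1] f) d a :=
  Iff.rfl

theorem fwdDiff_eventuallyEq {f g : ℕ → ℤ} (h : f =ᶠ[atTop] g) :
    Δ_[1] f =ᶠ[atTop] Δ_[1] g := by
  filter_upwards [h, (tendsto_add_atTop_nat 1).eventually h] with n hn hn'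
  rw [fwdDiff, fwdDiff, hn, hn']

theorem eventually_const_of_fwdDiff_eq_zero {f : ℕ → ℤ} (h : ∀ᶠ n in atTop, Δ_[1] f n = 0) :
    ∃ a, ∀ᶠ n in atTop, f n = a := by
  obtain ⟨N, hN⟩ := eventually_atTop.mp h
  refine ⟨f N, eventually_atTop.mpr ⟨N, fun n hn => ?_⟩⟩
  induction n, hn using Nat.le_induction with
  | base => rfl
  | succ n hn ih =>
    rw [← ih, ← sub_eq_zero]
    exact hN n hn

theorem eventually_pos_of_fwdDiff_pos {f : ℕ → ℤ} (h : ∀ᶠ n in atTop, 0 < Δ_[1] f n) :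
    ∀ᶠ n in atTop, 0 < f n := by
  obtain ⟨N, hN⟩ := eventually_atTop.mp h
  have hgrowth : ∀ n ≥ N, f N + (n - N : ℤ) ≤ f n := by
    intro n hn
    induction n, hn using Nat.le_induction with
    | base => simp
    | succ n hn ih =>
      have : 0 < f (n + 1) - f n := hN n hn
      push_cast
      linarith
  refine eventually_atTop.mpr ⟨N + (1 - f N).toNat, fun n hn => ?_⟩
  have := hgrowth n (by omega)
  omega

namespace HasLeadingTerm

variable {f g : ℕ → ℤ} {d e : ℕ} {a b : ℤ}

theorem congr (hf : HasLeadingTerm f d a) (h : f =ᶠ[atTop] g) : HasLeadingTerm g d a := by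
  induction d generalizing f g with
  | zero => filter_upwards [hf, h] with n hn hfg using hfg.symm.trans hn
  | succ d ih => exact ih (f := Δ_[1] f) hf (fwdDiff_eventuallyEq h)

theorem unique (ha : HasLeadingTerm f d a) (hb : HasLeadingTerm f d b) : a = b := by
  obtain ⟨n, hn, hn'⟩ := (ha.and hb).exists
  exact hn.symm.trans hn'

theorem add (hf : HasLeadingTerm f d a) (hg : HasLeadingTerm g d b) :
    HasLeadingTerm (f + g) d (a + b) := by
  filter_upwards [hf, hg] with n hn hn'
  rw [fwdDiff_iter_add, Pi.add_apply, hn, hn']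

theorem const_smul (hf : HasLeadingTerm f d a) (z : ℤ) : HasLeadingTerm (z • f) d (z * a) := by
  filter_upwards [hf] with n hn
  rw [fwdDiff_iter_const_smul, Pi.smul_apply, hn, smul_eq_mul]

theorem sub (hf : HasLeadingTerm f d a) (hg : HasLeadingTerm g d b) :
    HasLeadingTerm (f - g) d (a - b) := by
  convert hf.add (hg.const_smul (-1)) using 1
  · rw [neg_one_smul, sub_eq_add_neg]
  · rw [neg_one_mul, sub_eq_add_neg]

theorem sum {ι : Type*} {s : Finset ι} {F : ι → ℕ → ℤ} {A : ι → ℤ}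
    (h : ∀ i ∈ s, HasLeadingTerm (F i) d (A i)) :
    HasLeadingTerm (∑ i ∈ s, F i) d (∑ i ∈ s, A i) := by
  filter_upwards [(Finset.eventually_all s).mpr h] with n hn
  rw [fwdDiff_iter_finsetSum, Finset.sum_apply, Finset.sum_congr rfl hn]

theorem comp_add_iff (m : ℕ) :
    HasLeadingTerm (fun n => f (n + m)) d a ↔ HasLeadingTerm f d a := by
  conv_rhs => rw [HasLeadingTerm, ← map_add_atTop_eq_nat m, eventually_map]
  simp only [HasLeadingTerm, fwdDiff_iter_comp_add]

theorem succ (hf : HasLeadingTerm f d a) : HasLeadingTerm f (d + 1) 0 := by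
  filter_upwards [hf, (tendsto_add_atTop_nat 1).eventually hf] with n hn hn'
  rw [Function.iterate_succ_apply', fwdDiff, hn, hn', sub_self]

theorem mono (hf : HasLeadingTerm f d 0) (h : d ≤ e) : HasLeadingTerm f e 0 := by
  induction e, h using Nat.le_induction with
  | base => exact hf
  | succ e _ ih => exact ih.succ

theorem exists_of_succ (hf : HasLeadingTerm f (d + 1) 0) : ∃ a, HasLeadingTerm f d a := by
  refine eventually_const_of_fwdDiff_eq_zero ?_
  filter_upwards [hf] with n hn
  rwa [Function.iterate_succ_apply'] at hn

theorem add_const (hf : HasLeadingTerm f d a) (z : ℤ) :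
    HasLeadingTerm (fun n => f n + z) d (a + if d = 0 then z else 0) := by
  have hz : HasLeadingTerm (fun _ => z) d (if d = 0 then z else 0) := by
    have hconst : HasLeadingTerm (fun _ => z) 0 z := Eventually.of_forall fun _ => rfl
    split_ifs with hd
    · exact hd ▸ hconst
    · exact hconst.succ.mono (Nat.pos_of_ne_zero hd)
  exact hf.add hz

theorem eventually_pos (hf : HasLeadingTerm f d a) (ha : 0 < a) : ∀ᶠ n in atTop, 0 < f n := by
  induction d generalizing f with
  | zero => filter_upwards [hf] with n hn using ha.trans_eq hn.symm
  | succ d ih => exact eventually_pos_of_fwdDiff_pos (ih hf)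

theorem le (hf : HasLeadingTerm f d a) (hg : HasLeadingTerm g d b) (h : f ≤ᶠ[atTop] g) :
    a ≤ b := by
  by_contra! hlt
  obtain ⟨n, hpos, hle⟩ := (((hf.sub hg).eventually_pos (sub_pos.mpr hlt)).and h).exists
  exact hle.not_gt (sub_pos.mp hpos)

theorem of_le (hf : HasLeadingTerm f d 0) (hg : HasLeadingTerm g e 0) (h₀ : 0 ≤ᶠ[atTop] f)
    (hfg : f ≤ᶠ[atTop] g) : HasLeadingTerm f e 0 := by
  induction d with
  | zero => exact hf.mono e.zero_le
  | succ d ih =>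
    rcases Nat.lt_or_ge d e with hde | hed
    · exact hf.mono hde
    · obtain ⟨a, ha⟩ := hf.exists_of_succ
      have hzero : HasLeadingTerm 0 d 0 := by
        simpa using ha.sub ha
      have ha₀ : a = 0 := le_antisymm (ha.le (hg.mono hed) hfg) (hzero.le ha h₀)
      exact ih (ha₀ ▸ ha)

theorem comp_mul_add (hf : HasLeadingTerm f d a) {c : ℕ} (hc : 0 < c) (b : ℕ) :
    HasLeadingTerm (fun n => f (c * n + b)) d (c ^ d * a) := by
  induction d generalizing f b with
  | zero =>
    have htendsto : Tendsto (fun n => c * n + b) atTop atTop :=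
      tendsto_atTop_mono (fun n => (Nat.le_mul_of_pos_left n hc).trans (Nat.le_add_right _ b))
        tendsto_id
    rw [pow_zero, one_mul]
    exact htendsto.eventually hf
  | succ d ih =>
    have htelescope : Δ_[1] (fun n => f (c * n + b)) =
        ∑ i ∈ Finset.range c, fun n => (Δ_[1] f) (c * n + (b + i)) := by
      ext n
      have := Finset.sum_range_sub (fun i => f (c * n + b + i)) c
      simp only [fwdDiff, Finset.sum_apply, ← add_assoc] at this ⊢
      rw [this, add_zero, mul_add, mul_one, add_right_comm]
    rw [hasLeadingTerm_succ_iff, htelescope]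
    convert sum fun i _ => ih hf (b + i) using 1
    rw [Finset.sum_const, Finset.card_range, nsmul_eq_mul]
    ring

end HasLeadingTerm

/-- The function `n ↦ ∑ i, (-1) ^ i * c i * (n + d - i choose d - i)`, the form in which Hilbert
polynomials are expanded. -/
def binomialSum (d : ℕ) (c : Fin (d + 1) → ℤ) (n : ℕ) : ℤ :=
  ∑ i : Fin (d + 1), (-1) ^ (i : ℕ) * c i * ((n + d - i).choose (d - i) : ℤ)

theorem binomialSum_zero (c : Fin 1 → ℤ) (n : ℕ) : binomialSum 0 c n = c 0 := by
  simp [binomialSum]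

theorem binomialSum_succ (d : ℕ) (c : Fin (d + 2) → ℤ) :
    binomialSum (d + 1) c =
      (c 0 • fun n : ℕ => ((n + (d + 1)).choose (d + 1) : ℤ)) - binomialSum d (Fin.tail c) := by
  ext n
  rw [binomialSum, Fin.sum_univ_succ, Pi.sub_apply, binomialSum, sub_eq_add_neg,
    ← Finset.sum_neg_distrib]
  congr 1
  · simp
  · refine Finset.sum_congr rfl fun i _ => ?_
    rw [Fin.val_succ, Nat.add_sub_add_right, ← add_assoc, Nat.add_sub_add_right, pow_succ, Fin.tail]
    ring

theorem hasLeadingTerm_add_choose (d : ℕ) :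
    HasLeadingTerm (fun n => ((n + d).choose d : ℤ)) d 1 := by
  refine (HasLeadingTerm.comp_add_iff (f := fun n => (n.choose d : ℤ)) d).mpr ?_
  refine Eventually.of_forall fun n => ?_
  simpa using congrFun (fwdDiff_iter_choose 0 d) n

theorem hasLeadingTerm_binomialSum (d : ℕ) (c : Fin (d + 1) → ℤ) :
    HasLeadingTerm (binomialSum d c) d (c 0) := by
  induction d with
  | zero => exact Eventually.of_forall (binomialSum_zero c)
  | succ d ih =>
    rw [binomialSum_succ]
    simpa using ((hasLeadingTerm_add_choose (d + 1)).const_smul (c 0)).sub (ih _).succ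

theorem HasLeadingTerm.coeff_zero_eq {f : ℕ → ℤ} {d : ℕ} {a : ℤ} (hf : HasLeadingTerm f d a)
    {c : Fin (d + 1) → ℤ} (hc : f =ᶠ[atTop] binomialSum d c) : c 0 = a :=
  ((hasLeadingTerm_binomialSum d c).congr hc.symm).unique hf

theorem HasLeadingTerm.existsUnique_binomialSum {f : ℕ → ℤ} {d : ℕ} {a : ℤ}
    (hf : HasLeadingTerm f d a) : ∃! c, f =ᶠ[atTop] binomialSum d c := by
  induction d generalizing f a with
  | zero =>
    refine ⟨fun _ => a, ?_, fun c hc => ?_⟩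
    · filter_upwards [hf] with n hn
      rw [binomialSum_zero, ← hn, Function.iterate_zero_apply]
    · ext i
      rw [Fin.fin_one_eq_zero i, hf.coeff_zero_eq hc]
  | succ d ih =>
    set p : ℕ → ℤ := a • fun n : ℕ => ((n + (d + 1)).choose (d + 1) : ℤ)
    have hp : HasLeadingTerm p (d + 1) a := by
      simpa only [mul_one] using (hasLeadingTerm_add_choose (d + 1)).const_smul a
    obtain ⟨b, hb⟩ := (sub_self a ▸ hp.sub hf).exists_of_succ
    obtain ⟨c, hc, hunique⟩ := ih hb
    refine ⟨Fin.cons a c, ?_, fun c' hc' => ?_⟩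
    · filter_upwards [hc] with n hn
      simp [binomialSum_succ, ← hn, p]
    · have htail : Fin.tail c' = c := hunique _ <| by
        filter_upwards [hc'] with n hn
        rw [Pi.sub_apply, hn, binomialSum_succ, hf.coeff_zero_eq hc',
          Pi.sub_apply, sub_sub_cancel]
      rw [← Fin.cons_self_tail c', hf.coeff_zero_eq hc', htail]

/-- The values of `φ` as integers, where the junk value of `⊤` is `0`. -/
noncomputable def intValues (φ : ℕ → ℕ∞) (n : ℕ) : ℤ :=
  (φ n).toNat

theorem isBinomialCoefficients_iff {φ : ℕ → ℕ∞} {d : ℕ} {c : Fin (d + 1) → ℤ}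
    (hφ : ∀ᶠ n in atTop, φ n ≠ ⊤) :
    IsBinomialCoefficients φ d c ↔ intValues φ =ᶠ[atTop] binomialSum d c := by
  rw [IsBinomialCoefficients, eventually_and, and_iff_right hφ]
  rfl

theorem HasLeadingTerm.existsUnique_isBinomialCoefficients {φ : ℕ → ℕ∞} {d : ℕ} {a : ℤ}
    (hφ : ∀ᶠ n in atTop, φ n ≠ ⊤) (h : HasLeadingTerm (intValues φ) d a) :
    ∃! c, IsBinomialCoefficients φ d c := by
  simpa only [isBinomialCoefficients_iff hφ] using h.existsUnique_binomialSum

theorem HasLeadingTerm.leadingBinomialCoefficient_eq {φ : ℕ → ℕ∞} {d : ℕ} {a : ℤ}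
    (hφ : ∀ᶠ n in atTop, φ n ≠ ⊤) (h : HasLeadingTerm (intValues φ) d a) :
    leadingBinomialCoefficient φ d = a := by
  have hex := (h.existsUnique_isBinomialCoefficients hφ).exists
  rw [leadingBinomialCoefficient, dif_pos hex]
  exact h.coeff_zero_eq ((isBinomialCoefficients_iff hφ).mp hex.choose_spec)

end LeadingTerm

section FiniteLength

variable {R M : Type*} [CommRing R] [IsLocalRing R] [IsNoetherianRing R]

theorem isArtinianRing_quotient_maximalIdeal_pow (k : ℕ) :
    IsArtinianRing (R ⧸ maximalIdeal R ^ (k + 1)) := by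
  refine quotient_artinian_of_mem_minimalPrimes_of_isLocalRing _ ⟨⟨inferInstance, ?_⟩, ?_⟩
  · exact Ideal.pow_le_self k.succ_ne_zero
  · intro p hp _
    exact hp.1.le_of_pow_le hp.2

variable [AddCommGroup M] [Module R M] [Module.Finite R M]

theorem length_ne_top_of_maximalIdeal_pow_smul_eq_bot {k : ℕ}
    (h : maximalIdeal R ^ k • (⊤ : Submodule R M) = ⊥) : Module.length R M ≠ ⊤ := by
  have hart := isArtinianRing_quotient_maximalIdeal_pow (R := R) k
  have htors : Module.IsTorsionBySet R M (maximalIdeal R ^ (k + 1) : Ideal R) := by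
    rw [Module.isTorsionBySet_iff_subset_annihilator, SetLike.coe_subset_coe,
      ← Submodule.annihilator_top]
    exact (Ideal.pow_le_pow_right k.le_succ).trans (Submodule.le_annihilator_iff.mpr h)
  let _ := htors.module
  have : IsScalarTower R (R ⧸ maximalIdeal R ^ (k + 1)) M := htors.isScalarTower
  have : Module.Finite (R ⧸ maximalIdeal R ^ (k + 1)) M :=
    Module.Finite.of_restrictScalars_finite R _ M
  have : IsArtinian R M :=
    (LinearMap.isArtinian_iff_of_bijective htors.semilinearMap Function.bijective_id).mpr
      inferInstance
  exact Module.length_ne_top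

theorem relLength_ne_top_of_maximalIdeal_pow_smul_le {k : ℕ} {A B : Submodule R M}
    (h : maximalIdeal R ^ k • B ≤ A) : relLength A B ≠ ⊤ := by
  refine length_ne_top_of_maximalIdeal_pow_smul_eq_bot (k := k) ?_
  rw [eq_bot_iff, Submodule.smul_le]
  intro r hr y _
  obtain ⟨x, rfl⟩ := Submodule.mkQ_surjective _ y
  rw [← map_smul]
  exact (Submodule.Quotient.mk_eq_zero _).mpr (h (Submodule.smul_mem_smul hr x.2))

end FiniteLength

section Filtration

variable {R M N : Type*} [CommRing R] [AddCommGroup M] [Module R M] [AddCommGroup N] [Module R N]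
  {I : Ideal R}

/-- The filtration `F` with its indices shifted by `m`. -/
def shiftFiltration (F : I.Filtration M) (m : ℕ) : I.Filtration M where
  N n := F.N (n + m)
  mono n := F.antitone (by omega)
  smul_le n := (F.smul_le (n + m)).trans_eq (by rw [add_right_comm])

/-- The filtration formed by the images of the terms of `F` under a linear map. -/
def mapFiltration (φ : M →ₗ[R] N) (F : I.Filtration M) : I.Filtration N where
  N n := (F.N n).map φ
  mono n := Submodule.map_mono (F.mono n)
  smul_le n := by
    rw [← Submodule.map_smul'']
    exact Submodule.map_mono (F.smul_le n)

/-- The filtration formed by the preimages of the terms of `F` under a linear map. -/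
def comapFiltration (φ : M →ₗ[R] N) (F : I.Filtration N) : I.Filtration M where
  N n := (F.N n).comap φ
  mono n := Submodule.comap_mono (F.mono n)
  smul_le n := (Submodule.smul_comap_le_comap_smul φ _ I).trans (Submodule.comap_mono (F.smul_le n))

/-- The filtration formed by the submodules `F n :_M J`. -/
def colonFiltration (F : I.Filtration M) (J : Ideal R) : I.Filtration M where
  N n := moduleColon (F.N n) J
  mono n _ hx a ha := F.mono n (hx a ha)
  smul_le n := Submodule.smul_le.mpr fun r hr x hx a ha => by
    rw [smul_comm]
    exact F.smul_le n (Submodule.smul_mem_smul hr (hx a ha))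

theorem stable_shiftFiltration {F : I.Filtration M} (hF : F.Stable) (m : ℕ) :
    (shiftFiltration F m).Stable := by
  obtain ⟨n₀, hn₀⟩ := hF
  refine ⟨n₀, fun n hn => ?_⟩
  change I • F.N (n + m) = F.N (n + 1 + m)
  rw [hn₀ (n + m) (by omega), add_right_comm]

end Filtration

section MulMap

open fwdDiff

variable {R M : Type*} [CommRing R] [AddCommGroup M] [Module R M] {I J : Ideal R}
  {F G : I.Filtration M} {x : R}

/-- The degree `n` part of the kernel of multiplication by `x : G n / F n → G (n + 1) / F (n + 1)`
is the quotient of this submodule by `F n`. -/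
def mulKernel (F G : I.Filtration M) (x : R) : I.Filtration M :=
  G ⊓ comapFiltration (LinearMap.lsmul R M x) (shiftFiltration F 1)

/-- The degree `n` part of the cokernel of multiplication by
`x : G n / F n → G (n + 1) / F (n + 1)` is the quotient of `G (n + 1)` by this submodule. -/
def mulImage (F G : I.Filtration M) (x : R) : I.Filtration M :=
  shiftFiltration F 1 ⊔ mapFiltration (LinearMap.lsmul R M x) G

theorem le_comap_lsmul (hx : x ∈ I) (F : I.Filtration M) (n : ℕ) :
    F.N n ≤ (F.N (n + 1)).comap (LinearMap.lsmul R M x) := fun _ hy =>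
  F.smul_le n (Submodule.smul_mem_smul hx hy)

theorem le_mulKernel (hx : x ∈ I) (hFG : F ≤ G) : F ≤ mulKernel F G x :=
  le_inf hFG (le_comap_lsmul hx F)

theorem mulKernel_le : mulKernel F G x ≤ G :=
  inf_le_left

theorem mulImage_le (hx : x ∈ I) (hFG : F ≤ G) : mulImage F G x ≤ shiftFiltration G 1 :=
  sup_le (fun n => hFG (n + 1)) fun n => Submodule.map_le_iff_le_comap.mpr (le_comap_lsmul hx G n)

theorem smul_mulKernel_le (hJ : ∀ n, J • G.N n ≤ F.N (n + 1)) (n : ℕ) :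
    (J ⊔ Ideal.span {x}) • (mulKernel F G x).N n ≤ F.N (n + 1) := by
  rw [Submodule.sup_smul, Submodule.ideal_span_singleton_smul]
  refine sup_le ((smul_mono_right J (mulKernel_le n)).trans (hJ n)) ?_
  rintro _ ⟨y, hy, rfl⟩
  exact hy.2

theorem smul_le_mulImage (hJ : ∀ n, J • G.N n ≤ F.N (n + 1)) (n : ℕ) :
    (J ⊔ Ideal.span {x}) • (shiftFiltration G 1).N n ≤ (mulImage F G x).N (n + 1) := by
  rw [Submodule.sup_smul, Submodule.ideal_span_singleton_smul]
  exact sup_le_sup (hJ (n + 1)) le_rfl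

theorem relLength_mulKernel_ne_top (hx : x ∈ I) (hFG : F ≤ G)
    (hfin : ∀ n, relLength (F.N n) (G.N n) ≠ ⊤) (n : ℕ) :
    relLength (F.N n) ((mulKernel F G x).N n) ≠ ⊤ :=
  ne_top_of_le_ne_top (hfin n) (relLength_mono_right (le_mulKernel hx hFG n) (mulKernel_le n))

theorem relLength_mulImage_ne_top (hx : x ∈ I) (hFG : F ≤ G)
    (hfin : ∀ n, relLength (F.N n) (G.N n) ≠ ⊤) (n : ℕ) :
    relLength ((mulImage F G x).N n) ((shiftFiltration G 1).N n) ≠ ⊤ :=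
  ne_top_of_le_ne_top (hfin (n + 1)) (relLength_anti_left le_sup_left (mulImage_le hx hFG n))

theorem fwdDiff_relLength (hx : x ∈ I) (hFG : F ≤ G)
    (hfin : ∀ n, relLength (F.N n) (G.N n) ≠ ⊤) :
    Δ_[1] (intValues fun n => relLength (F.N n) (G.N n)) =
      (intValues fun n => relLength ((mulImage F G x).N n) ((shiftFiltration G 1).N n)) -
        intValues fun n => relLength (F.N n) ((mulKernel F G x).N n) := by
  ext n
  have hlength : relLength (F.N n) (G.N n) +
        relLength ((mulImage F G x).N n) ((shiftFiltration G 1).N n) =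
      relLength (F.N n) ((mulKernel F G x).N n) + relLength (F.N (n + 1)) (G.N (n + 1)) :=
    relLength_add_relLength_sup_map (LinearMap.lsmul R M x) (hFG n) (hFG (n + 1))
      (le_comap_lsmul hx F n) (le_comap_lsmul hx G n)
  have htoNat := congrArg ENat.toNat hlength
  rw [ENat.toNat_add (hfin n) (relLength_mulImage_ne_top hx hFG hfin n),
    ENat.toNat_add (relLength_mulKernel_ne_top hx hFG hfin n) (hfin (n + 1))] at htoNat
  simp only [fwdDiff, intValues, Pi.sub_apply]
  omega

end MulMap

section HilbertSerre

variable {R M : Type*} [CommRing R] [IsNoetherianRing R] [AddCommGroup M] [Module R M]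
  [Module.Finite R M] {I : Ideal R}

/-- The Hilbert–Serre theorem for the graded module `⨁ G n / F n`, which is generated in finitely
many degrees because `G` is stable. The elements of `I` act on it with degree one and those of `J`
act as zero, so it is a module over a polynomial ring with one variable for each element of `s`. -/
theorem hasLeadingTerm_relLength_of_stable {s : Finset R} (hs : (s : Set R) ⊆ I)
    {F G : I.Filtration M} (hFG : F ≤ G) (hG : G.Stable)
    (hfin : ∀ n, relLength (F.N n) (G.N n) ≠ ⊤) {J : Ideal R}
    (hJ : ∀ n, J • G.N n ≤ F.N (n + 1)) (hI : I ≤ Ideal.span s ⊔ J) :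
    HasLeadingTerm (intValues fun n => relLength (F.N n) (G.N n)) s.card 0 := by
  classical
  induction s using Finset.induction_on generalizing F G J with
  | empty =>
    rw [Finset.coe_empty, Ideal.span_empty, bot_sup_eq] at hI
    obtain ⟨n₀, hn₀⟩ := hG
    refine (HasLeadingTerm.comp_add_iff 1).mp ?_
    filter_upwards [eventually_ge_atTop n₀] with n hn
    have hle : G.N (n + 1) ≤ F.N (n + 1) := by
      rw [← hn₀ n hn]
      exact (Submodule.smul_mono_left hI).trans (hJ n)
    simp [intValues, relLength_eq_zero_of_le hle]
  | insert x s hxs ih =>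
    rw [Finset.coe_insert, Set.insert_subset_iff] at hs
    obtain ⟨hx, hs⟩ := hs
    have hspan : I ≤ Ideal.span s ⊔ (J ⊔ Ideal.span {x}) := by
      rwa [Finset.coe_insert, Ideal.span_insert, sup_comm (Ideal.span {x}), sup_assoc,
        sup_comm (Ideal.span {x})] at hI
    have hker := ih hs (le_mulKernel hx hFG) (hG.of_le mulKernel_le)
      (relLength_mulKernel_ne_top hx hFG hfin) (smul_mulKernel_le hJ) hspan
    have hcoker := ih hs (mulImage_le hx hFG) (stable_shiftFiltration hG 1)
      (relLength_mulImage_ne_top hx hFG hfin) (smul_le_mulImage hJ) hspan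
    rw [Finset.card_insert_of_notMem hxs, hasLeadingTerm_succ_iff, fwdDiff_relLength hx hFG hfin]
    exact hcoker.sub hker

theorem exists_hasLeadingTerm_relLength {F G : I.Filtration M} (hFG : F ≤ G) (hG : G.Stable)
    (hfin : ∀ n, relLength (F.N n) (G.N n) ≠ ⊤) :
    ∃ d, HasLeadingTerm (intValues fun n => relLength (F.N n) (G.N n)) d 0 := by
  obtain ⟨s, hs⟩ : I.FG := IsNoetherian.noetherian I
  refine ⟨s.card, hasLeadingTerm_relLength_of_stable (J := ⊥) ?_ hFG hG hfin (fun n => ?_) ?_⟩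
  · exact hs ▸ Submodule.subset_span
  · rw [Submodule.bot_smul]
    exact bot_le
  · rw [sup_bot_eq]
    exact hs.ge

end HilbertSerre

section SystemOfParameters

variable {R M : Type*} [CommRing R] [IsLocalRing R] [IsNoetherianRing R]

theorem exists_finset_card_eq_ringKrullDim :
    ∃ s : Finset R, (s.card : WithBot ℕ∞) = ringKrullDim R ∧
      Ideal.span (s : Set R) ≤ maximalIdeal R ∧ ∃ k, maximalIdeal R ^ k ≤ Ideal.span s := by
  obtain ⟨s, hs, hcard⟩ := (maximalIdeal R).exists_finset_card_eq_height_of_isNoetherianRing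
  have := quotient_artinian_of_mem_minimalPrimes_of_isLocalRing _ hs
  refine ⟨s, ?_, hs.1.2, exists_maximalIdeal_pow_le_of_isArtinianRing_quotient _⟩
  rw [← maximalIdeal_height_eq_ringKrullDim, ← hcard]
  rfl

theorem exists_finset_card_eq_ringKrullDim_quotient {a : Ideal R} (ha : a ≠ ⊤) :
    ∃ s : Finset R, (s.card : WithBot ℕ∞) = ringKrullDim (R ⧸ a) ∧
      Ideal.span (s : Set R) ≤ maximalIdeal R ∧
      ∃ k, maximalIdeal R ^ k ≤ Ideal.span s ⊔ a := by
  classical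
  have : Nontrivial (R ⧸ a) := Ideal.Quotient.nontrivial_iff.mpr ha
  have hsurj : Function.Surjective (Ideal.Quotient.mk a) := Ideal.Quotient.mk_surjective
  have : IsLocalRing (R ⧸ a) := IsLocalRing.of_surjective' _ hsurj
  have : IsLocalHom (Ideal.Quotient.mk a) := IsLocalHom.of_surjective _ hsurj
  obtain ⟨t, hcard, hle, k, hk⟩ := exists_finset_card_eq_ringKrullDim (R := R ⧸ a)
  obtain ⟨s, -, hinj, rfl⟩ := Finset.exists_subset_injOn_image_eq_of_surjOn
    (f := Ideal.Quotient.mk a) Set.univ t fun y _ => (hsurj y).imp fun x hx => ⟨trivial, hx⟩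
  rw [Finset.coe_image, ← Ideal.map_span] at hle hk
  refine ⟨s, by rwa [Finset.card_image_of_injOn hinj] at hcard, ?_, k, ?_⟩
  · rw [← maximalIdeal_comap (Ideal.Quotient.mk a)]
    exact Ideal.map_le_iff_le_comap.mp hle
  · rw [← maximalIdeal_comap (Ideal.Quotient.mk a)]
    refine (Ideal.le_comap_pow _ k).trans ((Ideal.comap_mono hk).trans_eq ?_)
    rw [Ideal.comap_map_of_surjective' _ hsurj, Ideal.mk_ker]

variable [AddCommGroup M] [Module R M] [Module.Finite R M]

theorem exists_finset_card_eq_supportDim [Nontrivial M] :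
    ∃ s : Finset R, (s.card : WithBot ℕ∞) = Module.supportDim R M ∧
      Ideal.span (s : Set R) ≤ maximalIdeal R ∧
      ∃ k, maximalIdeal R ^ k • (⊤ : Submodule R M) ≤ Ideal.span (s : Set R) • ⊤ := by
  have hann : Module.annihilator R M ≠ ⊤ := by
    rwa [Ne, Module.annihilator_eq_top_iff, not_subsingleton_iff_nontrivial]
  obtain ⟨s, hcard, hle, k, hk⟩ := exists_finset_card_eq_ringKrullDim_quotient hann
  rw [← Module.supportDim_eq_ringKrullDim_quotient_annihilator] at hcard
  refine ⟨s, hcard, hle, k, (Submodule.smul_mono_left hk).trans_eq ?_⟩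
  rw [Submodule.sup_smul, ← Submodule.annihilator_top, Submodule.annihilator_smul, sup_bot_eq]

end SystemOfParameters

section HilbertFunction

open fwdDiff

variable {R M : Type*} [CommRing R] [AddCommGroup M] [Module R M] {I J : Ideal R} {k : ℕ}

/-- The length of `I ^ n M / I ^ (n + 1) M`, the degree `n` part of the associated graded module. -/
noncomputable def gradedLength (M : Type*) [AddCommGroup M] [Module R M] (I : Ideal R) (n : ℕ) :
    ℕ∞ :=
  relLength (I ^ (n + 1) • ⊤ : Submodule R M) (I ^ n • ⊤)

theorem pow_smul_top_antitone (M : Type*) [AddCommGroup M] [Module R M] (I : Ideal R) :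
    Antitone fun n => (I ^ n • ⊤ : Submodule R M) := fun _ _ h =>
  Submodule.smul_mono_left (Ideal.pow_le_pow_right h)

theorem hilbertFunction_eq_relLength (n : ℕ) :
    hilbertFunction M I n = relLength (I ^ (n + 1) • ⊤ : Submodule R M) ⊤ :=
  (relLength_top _).symm

theorem hilbertFunction_succ (n : ℕ) :
    hilbertFunction M I (n + 1) = gradedLength M I (n + 1) + hilbertFunction M I n := by
  rw [hilbertFunction_eq_relLength, hilbertFunction_eq_relLength]
  exact relLength_add (pow_smul_top_antitone M I (n + 1).le_succ) le_top

theorem gradedLength_le_hilbertFunction (n : ℕ) : gradedLength M I n ≤ hilbertFunction M I n := by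
  rw [hilbertFunction_eq_relLength]
  exact relLength_mono_right (pow_smul_top_antitone M I n.le_succ) le_top

theorem pow_mul_smul_top_le (h : J ^ k • (⊤ : Submodule R M) ≤ I • ⊤) (n : ℕ) :
    J ^ (k * n) • (⊤ : Submodule R M) ≤ I ^ n • ⊤ := by
  induction n with
  | zero => simp
  | succ n ih =>
    calc J ^ (k * (n + 1)) • (⊤ : Submodule R M)
        = J ^ k • J ^ (k * n) • ⊤ := by rw [← mul_smul, ← pow_add, mul_add_one, add_comm]
      _ ≤ J ^ k • I ^ n • ⊤ := smul_mono_right _ ih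
      _ = I ^ n • J ^ k • ⊤ := by rw [smul_comm]
      _ ≤ I ^ n • I • ⊤ := smul_mono_right _ h
      _ = I ^ (n + 1) • ⊤ := by rw [← mul_smul, pow_succ]

theorem hilbertFunction_le_comp_mul_add (h : J ^ (k + 1) • (⊤ : Submodule R M) ≤ I • ⊤) (n : ℕ) :
    hilbertFunction M I n ≤ hilbertFunction M J ((k + 1) * n + k) := by
  rw [hilbertFunction_eq_relLength, hilbertFunction_eq_relLength, add_assoc, ← mul_add_one]
  exact relLength_anti_left (pow_mul_smul_top_le h (n + 1)) le_top

variable [IsLocalRing R] [IsNoetherianRing R] [Module.Finite R M]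

theorem hilbertFunction_ne_top (hk : maximalIdeal R ^ k • (⊤ : Submodule R M) ≤ I • ⊤) (n : ℕ) :
    hilbertFunction M I n ≠ ⊤ := by
  rw [hilbertFunction_eq_relLength]
  exact relLength_ne_top_of_maximalIdeal_pow_smul_le (pow_mul_smul_top_le hk (n + 1))

theorem gradedLength_ne_top (hk : maximalIdeal R ^ k • (⊤ : Submodule R M) ≤ I • ⊤) (n : ℕ) :
    gradedLength M I n ≠ ⊤ :=
  ne_top_of_le_ne_top (hilbertFunction_ne_top hk n) (gradedLength_le_hilbertFunction n)

theorem fwdDiff_hilbertFunction (hk : maximalIdeal R ^ k • (⊤ : Submodule R M) ≤ I • ⊤) :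
    Δ_[1] (intValues (hilbertFunction M I)) = fun n => intValues (gradedLength M I) (n + 1) := by
  ext n
  rw [fwdDiff, intValues, intValues, hilbertFunction_succ,
    ENat.toNat_add (gradedLength_ne_top hk _) (hilbertFunction_ne_top hk n), Nat.cast_add,
    add_sub_cancel_right]
  rfl

theorem hasLeadingTerm_hilbertFunction_succ_iff
    (hk : maximalIdeal R ^ k • (⊤ : Submodule R M) ≤ I • ⊤) {d : ℕ} {a : ℤ} :
    HasLeadingTerm (intValues (hilbertFunction M I)) (d + 1) a ↔
      HasLeadingTerm (intValues (gradedLength M I)) d a := by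
  rw [hasLeadingTerm_succ_iff, fwdDiff_hilbertFunction hk, HasLeadingTerm.comp_add_iff]

theorem hasLeadingTerm_gradedLength_span {s : Finset R}
    (hk : maximalIdeal R ^ k • (⊤ : Submodule R M) ≤ Ideal.span (s : Set R) • ⊤) :
    HasLeadingTerm (intValues (gradedLength M (Ideal.span (s : Set R)))) s.card 0 := by
  set G := (Ideal.span (s : Set R)).stableFiltration (⊤ : Submodule R M)
  refine hasLeadingTerm_relLength_of_stable (F := shiftFiltration G 1) (G := G) (J := ⊥)
    Ideal.subset_span G.mono (Ideal.stableFiltration_stable _ _) (gradedLength_ne_top hk)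
    (fun n => ?_) le_sup_left
  rw [Submodule.bot_smul]
  exact bot_le

theorem exists_hasLeadingTerm_gradedLength
    (hk : maximalIdeal R ^ k • (⊤ : Submodule R M) ≤ I • ⊤) :
    ∃ d, HasLeadingTerm (intValues (gradedLength M I)) d 0 := by
  obtain ⟨s, rfl⟩ : I.FG := IsNoetherian.noetherian I
  exact ⟨s.card, hasLeadingTerm_gradedLength_span hk⟩

theorem exists_hasLeadingTerm_hilbertFunction
    (hk : maximalIdeal R ^ k • (⊤ : Submodule R M) ≤ I • ⊤) {t : ℕ}
    (ht : Module.supportDim R M = t) :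
    ∃ e, HasLeadingTerm (intValues (hilbertFunction M I)) t e := by
  have : Nontrivial M := by
    rw [← Module.supportDim_ne_bot_iff_nontrivial R, ht]
    exact WithBot.coe_ne_bot
  obtain ⟨s, hcard, hle, l, hl⟩ := exists_finset_card_eq_supportDim (R := R) (M := M)
  obtain rfl : s.card = t := by exact_mod_cast hcard.trans ht
  set J := Ideal.span (s : Set R)
  have hJI : J ^ (k + 1) • (⊤ : Submodule R M) ≤ I • ⊤ :=
    (pow_smul_top_antitone M J k.le_succ).trans
      ((Submodule.smul_mono_left (Ideal.pow_right_mono hle k)).trans hk)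
  have hHJ : HasLeadingTerm (intValues (hilbertFunction M J)) (s.card + 1) 0 :=
    (hasLeadingTerm_hilbertFunction_succ_iff hl).mpr (hasLeadingTerm_gradedLength_span hl)
  obtain ⟨d, hd⟩ := exists_hasLeadingTerm_gradedLength hk
  refine HasLeadingTerm.exists_of_succ
    (((hasLeadingTerm_hilbertFunction_succ_iff hk).mpr hd).of_le
      (mul_zero (_ : ℤ) ▸ hHJ.comp_mul_add k.succ_pos k) ?_ ?_)
  · exact Eventually.of_forall fun n => Int.natCast_nonneg _
  · exact Eventually.of_forall fun n => Nat.cast_le.mpr <|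
      ENat.toNat_le_toNat (hilbertFunction_le_comp_mul_add hJI n) (hilbertFunction_ne_top hl _)

theorem hasLeadingTerm_hilbertFunction
    (hk : maximalIdeal R ^ k • (⊤ : Submodule R M) ≤ I • ⊤) {t : ℕ}
    (ht : Module.supportDim R M = t) :
    HasLeadingTerm (intValues (hilbertFunction M I)) t (hilbertMultiplicity M I t) := by
  obtain ⟨e, he⟩ := exists_hasLeadingTerm_hilbertFunction hk ht
  rwa [hilbertMultiplicity,
    he.leadingBinomialCoefficient_eq (Eventually.of_forall (hilbertFunction_ne_top hk))]

end HilbertFunction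

section Colon

variable {R M : Type*} [CommRing R] [AddCommGroup M] [Module R M] {N N' : Submodule R M}
  {I J J' : Ideal R}

theorem moduleColon_mono_left (h : N ≤ N') : moduleColon N J ≤ moduleColon N' J :=
  fun _ hx a ha => h (hx a ha)

theorem moduleColon_anti_right (h : J ≤ J') : moduleColon N J' ≤ moduleColon N J :=
  fun _ hx a ha => hx a (h ha)

theorem le_moduleColon : N ≤ moduleColon N J :=
  fun _ hx a _ => N.smul_mem a hx

theorem le_moduleColon_iff : N' ≤ moduleColon N J ↔ J • N' ≤ N :=
  ⟨fun h => Submodule.smul_le.mpr fun a ha _ hx => h hx a ha,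
    fun h _ hx _ ha => h (Submodule.smul_mem_smul ha hx)⟩

theorem smul_moduleColon_le : J • moduleColon N J ≤ N :=
  le_moduleColon_iff.mp le_rfl

theorem mem_moduleColon_span {s : Set R} {x : M} :
    x ∈ moduleColon N (Ideal.span s) ↔ ∀ a ∈ s, a • x ∈ N :=
  ⟨fun hx a ha => hx a (Ideal.subset_span ha), fun hx _ ha =>
    Ideal.span_le (I := N.comap (LinearMap.toSpanSingleton R M x)).mpr hx ha⟩

theorem mem_smul_top_of_forall_mem {ι : Type*} [Finite ι] {f : ι → M}
    (h : ∀ i, f i ∈ (J • ⊤ : Submodule R M)) : f ∈ (J • ⊤ : Submodule R (ι → M)) := by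
  classical
  have := Fintype.ofFinite ι
  rw [← Finset.univ_sum_single f]
  refine Submodule.sum_mem _ fun i _ => ?_
  have hle : (J • ⊤ : Submodule R M).map (LinearMap.single R (fun _ => M) i) ≤ J • ⊤ := by
    rw [Submodule.map_smul'']
    exact smul_mono_right J le_top
  exact hle (Submodule.mem_map_of_mem (h i))

variable [IsNoetherianRing R] [Module.Finite R M]

/-- Artin–Rees for the image of `M → M ^ s`, `x ↦ (a x)_{a ∈ s}`, where `s` generates `J`. -/
theorem exists_moduleColon_pow_smul_top_le (I J : Ideal R) :
    ∃ k, ∀ n ≥ k, moduleColon (I ^ n • ⊤ : Submodule R M) J ≤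
      moduleColon ⊥ J ⊔ I ^ (n - k) • ⊤ := by
  obtain ⟨s, rfl⟩ : J.FG := IsNoetherian.noetherian J
  let φ : M →ₗ[R] (s → M) := LinearMap.pi fun a => LinearMap.lsmul R M a
  obtain ⟨k, hk⟩ := I.exists_pow_inf_eq_pow_smul (LinearMap.range φ)
  refine ⟨k, fun n hn x hx => ?_⟩
  have hφx : φ x ∈ I ^ n • ⊤ ⊓ LinearMap.range φ :=
    ⟨mem_smul_top_of_forall_mem fun a => hx a (Ideal.subset_span a.2), x, rfl⟩
  have hmap : φ x ∈ (I ^ (n - k) • ⊤ : Submodule R M).map φ := by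
    rw [hk n hn] at hφx
    rw [Submodule.map_smul'', ← LinearMap.range_eq_map]
    exact (smul_mono_right (I ^ (n - k)) inf_le_right : _ ≤ I ^ (n - k) • LinearMap.range φ) hφx
  obtain ⟨z, hz, hzx⟩ := hmap
  refine Submodule.mem_sup.mpr ⟨x - z, ?_, z, hz, sub_add_cancel x z⟩
  refine mem_moduleColon_span.mpr fun a ha => ?_
  have haz : a • z = a • x := congrFun hzx ⟨a, ha⟩
  rw [Submodule.mem_bot, smul_sub, haz, sub_self]

theorem eventually_moduleColon_add_two_inf_le (I : Ideal R) :
    ∀ᶠ n in atTop, moduleColon (I ^ (n + 2) • ⊤ : Submodule R M) I ⊓ I ^ n • ⊤ ≤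
      I ^ (n + 1) • ⊤ := by
  let G := I.stableFiltration (⊤ : Submodule R M)
  let C := colonFiltration (shiftFiltration G 2) I ⊓ G
  obtain ⟨n₀, hn₀⟩ : C.Stable := (I.stableFiltration_stable ⊤).of_le inf_le_right
  refine eventually_atTop.mpr ⟨n₀ + 1, fun n hn => ?_⟩
  obtain ⟨j, rfl⟩ := Nat.exists_eq_add_of_le' (Nat.one_le_of_lt hn)
  calc C.N (j + 1) = I • C.N j := (hn₀ j (by omega)).symm
    _ ≤ I • moduleColon (I ^ (j + 2) • ⊤) I := smul_mono_right I inf_le_left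
    _ ≤ I ^ (j + 2) • ⊤ := smul_moduleColon_le

theorem eventually_moduleColon_inf_pow_smul_top_le (I : Ideal R) :
    ∀ᶠ c in atTop, ∀ n ≥ c,
      moduleColon (I ^ (n + 1) • ⊤ : Submodule R M) I ⊓ I ^ c • ⊤ ≤ I ^ n • ⊤ := by
  obtain ⟨n₀, hn₀⟩ := eventually_atTop.mp (eventually_moduleColon_add_two_inf_le (M := M) I)
  filter_upwards [eventually_ge_atTop n₀] with c hc n hn
  induction n, hn using Nat.le_induction with
  | base => exact inf_le_right
  | succ n hcn ih =>
    have hcolon : moduleColon (I ^ (n + 2) • ⊤ : Submodule R M) I ≤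
        moduleColon (I ^ (n + 1) • ⊤) I :=
      moduleColon_mono_left (pow_smul_top_antitone M I (n + 1).le_succ)
    exact (le_inf inf_le_left ((inf_le_inf_right _ hcolon).trans ih)).trans (hn₀ n (hc.trans hcn))

theorem eventually_moduleColon_bot_inf_pow_smul_top_eq_bot (I : Ideal R) :
    ∀ᶠ n in atTop, moduleColon (⊥ : Submodule R M) I ⊓ I ^ n • ⊤ = ⊥ := by
  obtain ⟨k, hk⟩ := I.exists_pow_inf_eq_pow_smul (moduleColon (⊥ : Submodule R M) I)
  filter_upwards [eventually_gt_atTop k] with n hn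
  rw [inf_comm, hk n hn.le, eq_bot_iff]
  calc I ^ (n - k) • (I ^ k • ⊤ ⊓ moduleColon ⊥ I)
      ≤ I ^ (n - k) • moduleColon (⊥ : Submodule R M) I := smul_mono_right _ inf_le_right
    _ ≤ I • moduleColon ⊥ I := Submodule.smul_mono_left (Ideal.pow_le_self (by omega))
    _ ≤ ⊥ := smul_moduleColon_le

theorem eventually_moduleColon_pow_smul_top_eq_sup (hIJ : I ≤ J) :
    ∀ᶠ n in atTop, moduleColon (I ^ (n + 1) • ⊤ : Submodule R M) J =
      (moduleColon (I ^ (n + 1) • ⊤) J ⊓ I ^ n • ⊤) ⊔ moduleColon ⊥ J := by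
  obtain ⟨k, hk⟩ := exists_moduleColon_pow_smul_top_le (M := M) I J
  obtain ⟨c, hc⟩ := (eventually_moduleColon_inf_pow_smul_top_le (M := M) I).exists
  filter_upwards [eventually_ge_atTop (k + c)] with n hn
  have hbot : moduleColon ⊥ J ≤ moduleColon (I ^ (n + 1) • ⊤ : Submodule R M) J :=
    moduleColon_mono_left bot_le
  refine le_antisymm ?_ (sup_le inf_le_left hbot)
  calc moduleColon (I ^ (n + 1) • ⊤) J
      ≤ moduleColon (I ^ (n + 1) • ⊤) J ⊓ (I ^ c • ⊤ ⊔ moduleColon ⊥ J) := le_inf le_rfl <| by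
        rw [sup_comm]
        refine (hk (n + 1) (by omega)).trans (sup_le_sup_left ?_ _)
        exact pow_smul_top_antitone M I (by omega)
    _ = moduleColon (I ^ (n + 1) • ⊤) J ⊓ I ^ c • ⊤ ⊔ moduleColon ⊥ J :=
        (inf_sup_assoc_of_le _ hbot).symm
    _ ≤ moduleColon (I ^ (n + 1) • ⊤) J ⊓ I ^ n • ⊤ ⊔ moduleColon ⊥ J :=
        sup_le_sup_right (le_inf inf_le_left
          ((inf_le_inf_right _ (moduleColon_anti_right hIJ)).trans (hc n (by omega)))) _

end Colon

section Irreducibility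

variable {R M : Type*} [CommRing R] [IsLocalRing R] [AddCommGroup M] [Module R M]
  {I : Ideal R} {k t : ℕ}

/-- The degree `n` part of the socle of the associated graded module of `M` is the quotient of
this submodule by `I ^ (n + 1) M`. -/
def gradedSocle (M : Type*) [AddCommGroup M] [Module R M] (I : Ideal R) : I.Filtration M :=
  colonFiltration (shiftFiltration (I.stableFiltration ⊤) 1) (maximalIdeal R) ⊓
    I.stableFiltration ⊤

/-- The length of the degree `n` part of the socle of the associated graded module of `M`. -/
noncomputable def gradedSocleLength (M : Type*) [AddCommGroup M] [Module R M] (I : Ideal R)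
    (n : ℕ) : ℕ∞ :=
  relLength (I ^ (n + 1) • ⊤) ((gradedSocle M I).N n)

theorem gradedSocle_le_moduleColon (n : ℕ) :
    (gradedSocle M I).N n ≤ moduleColon (I ^ (n + 1) • ⊤) (maximalIdeal R) :=
  inf_le_left

theorem le_gradedSocle (n : ℕ) : I ^ (n + 1) • ⊤ ≤ (gradedSocle M I).N n :=
  le_inf le_moduleColon (pow_smul_top_antitone M I n.le_succ)

theorem gradedSocle_eq_of_smul_le {m n : ℕ}
    (hm : maximalIdeal R • (I ^ m • ⊤ : Submodule R M) ≤ I ^ (m + 1) • ⊤) (hmn : m ≤ n) :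
    (gradedSocle M I).N n = I ^ n • ⊤ := by
  refine inf_eq_right.mpr (le_moduleColon_iff.mpr ?_)
  obtain ⟨i, rfl⟩ := Nat.exists_eq_add_of_le' hmn
  calc maximalIdeal R • I ^ (i + m) • (⊤ : Submodule R M)
      = I ^ i • maximalIdeal R • I ^ m • ⊤ := by rw [pow_add, mul_smul, smul_comm]
    _ ≤ I ^ i • I ^ (m + 1) • ⊤ := smul_mono_right _ hm
    _ = I ^ (i + m + 1) • ⊤ := by rw [← mul_smul, ← pow_add, add_assoc]

theorem gradedSocleLength_le_gradedLength (n : ℕ) :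
    gradedSocleLength M I n ≤ gradedLength M I n :=
  relLength_mono_right (le_gradedSocle n) inf_le_right

theorem irreducibilityFunction_le_hilbertFunction (n : ℕ) :
    irreducibilityFunction M I n ≤ hilbertFunction M I n := by
  rw [hilbertFunction_eq_relLength]
  exact relLength_mono_right le_moduleColon le_top

variable [IsNoetherianRing R] [Module.Finite R M]

theorem relLength_ne_top_of_le_moduleColon {A B : Submodule R M}
    (h : B ≤ moduleColon A (maximalIdeal R)) : relLength A B ≠ ⊤ := by
  refine relLength_ne_top_of_maximalIdeal_pow_smul_le (k := 1) ?_
  rwa [pow_one, ← le_moduleColon_iff]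

theorem length_moduleColon_bot_ne_top :
    Module.length R (moduleColon (⊥ : Submodule R M) (maximalIdeal R)) ≠ ⊤ := by
  rw [← relLength_bot]
  exact relLength_ne_top_of_le_moduleColon le_rfl

theorem irreducibilityFunction_ne_top (n : ℕ) : irreducibilityFunction M I n ≠ ⊤ :=
  relLength_ne_top_of_le_moduleColon le_rfl

theorem gradedSocleLength_ne_top (n : ℕ) : gradedSocleLength M I n ≠ ⊤ :=
  relLength_ne_top_of_le_moduleColon (gradedSocle_le_moduleColon n)

theorem irreducibilityFunction_eventuallyEq (hI : I ≤ maximalIdeal R) :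
    irreducibilityFunction M I =ᶠ[atTop] fun n => gradedSocleLength M I n +
      Module.length R (moduleColon (⊥ : Submodule R M) (maximalIdeal R)) := by
  filter_upwards [eventually_moduleColon_pow_smul_top_eq_sup (M := M) hI,
    eventually_moduleColon_bot_inf_pow_smul_top_eq_bot (M := M) I] with n hsup hbot
  have hdisj : (gradedSocle M I).N n ⊓ moduleColon ⊥ (maximalIdeal R) = ⊥ := by
    rw [inf_comm]
    exact eq_bot_mono (inf_le_inf (moduleColon_anti_right hI) inf_le_right) hbot
  calc irreducibilityFunction M I n
      = gradedSocleLength M I n + relLength ((gradedSocle M I).N n)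
          (moduleColon (I ^ (n + 1) • ⊤) (maximalIdeal R)) :=
        relLength_add (le_gradedSocle n) (gradedSocle_le_moduleColon n)
    _ = gradedSocleLength M I n + relLength ((gradedSocle M I).N n)
          ((gradedSocle M I).N n ⊔ moduleColon ⊥ (maximalIdeal R)) :=
        congrArg (gradedSocleLength M I n + relLength _ ·) hsup
    _ = gradedSocleLength M I n + Module.length R (moduleColon ⊥ (maximalIdeal R)) := by
        rw [relLength_sup, hdisj, relLength_bot]

theorem intValues_irreducibilityFunction_eventuallyEq (hI : I ≤ maximalIdeal R) :
    intValues (irreducibilityFunction M I) =ᶠ[atTop] fun n =>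
      intValues (gradedSocleLength M I) n +
        (Module.length R (moduleColon (⊥ : Submodule R M) (maximalIdeal R))).toNat := by
  filter_upwards [irreducibilityFunction_eventuallyEq (M := M) hI] with n hn
  rw [intValues, intValues, hn,
    ENat.toNat_add (gradedSocleLength_ne_top n) length_moduleColon_bot_ne_top, Nat.cast_add]

theorem intValues_gradedSocleLength_le
    (hk : maximalIdeal R ^ k • (⊤ : Submodule R M) ≤ I • ⊤) (n : ℕ) :
    intValues (gradedSocleLength M I) n ≤ intValues (gradedLength M I) n :=
  Nat.cast_le.mpr (ENat.toNat_le_toNat (gradedSocleLength_le_gradedLength n)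
    (gradedLength_ne_top hk n))

theorem hasLeadingTerm_gradedSocleLength
    (hk : maximalIdeal R ^ k • (⊤ : Submodule R M) ≤ I • ⊤)
    (ht : Module.supportDim R M = t) :
    HasLeadingTerm (intValues (gradedSocleLength M I)) t 0 := by
  have hgraded : HasLeadingTerm (intValues (gradedLength M I)) t 0 :=
    (hasLeadingTerm_hilbertFunction_succ_iff hk).mp (hasLeadingTerm_hilbertFunction hk ht).succ
  obtain ⟨d, hd⟩ := exists_hasLeadingTerm_relLength
    (F := shiftFiltration (I.stableFiltration ⊤) 1) (G := gradedSocle M I) le_gradedSocle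
    ((I.stableFiltration_stable ⊤).of_le inf_le_right) gradedSocleLength_ne_top
  exact hd.of_le hgraded (Eventually.of_forall fun n => Int.natCast_nonneg _)
    (Eventually.of_forall (intValues_gradedSocleLength_le hk))

theorem exists_hasLeadingTerm_irreducibilityFunction (hI : I ≤ maximalIdeal R)
    (hk : maximalIdeal R ^ k • (⊤ : Submodule R M) ≤ I • ⊤)
    (ht : Module.supportDim R M = t) :
    ∃ f, HasLeadingTerm (intValues (irreducibilityFunction M I)) (t - 1) f := by
  have hsocle : HasLeadingTerm (intValues (gradedSocleLength M I)) (t - 1 + 1) 0 :=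
    (hasLeadingTerm_gradedSocleLength hk ht).mono (by omega)
  obtain ⟨a, ha⟩ := hsocle.exists_of_succ
  exact ⟨_, (ha.add_const _).congr (intValues_irreducibilityFunction_eventuallyEq hI).symm⟩

theorem hasLeadingTerm_irreducibilityFunction (hI : I ≤ maximalIdeal R)
    (hk : maximalIdeal R ^ k • (⊤ : Submodule R M) ≤ I • ⊤)
    (ht : Module.supportDim R M = t) :
    HasLeadingTerm (intValues (irreducibilityFunction M I)) (t - 1)
      (irreducibleMultiplicity M I t) := by
  obtain ⟨f, hf⟩ := exists_hasLeadingTerm_irreducibilityFunction hI hk ht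
  rwa [irreducibleMultiplicity,
    hf.leadingBinomialCoefficient_eq (Eventually.of_forall irreducibilityFunction_ne_top)]

theorem hasLeadingTerm_gradedLength_add_length
    (hk : maximalIdeal R ^ k • (⊤ : Submodule R M) ≤ I • ⊤)
    (ht : Module.supportDim R M = t) (ht₁ : 1 ≤ t) :
    HasLeadingTerm
      (fun n => intValues (gradedLength M I) n +
        (Module.length R (moduleColon (⊥ : Submodule R M) (maximalIdeal R))).toNat)
      (t - 1)
      (hilbertMultiplicity M I t + if t = 1 then
        ((Module.length R (moduleColon (⊥ : Submodule R M) (maximalIdeal R))).toNat : ℤ)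
        else 0) := by
  obtain ⟨d, rfl⟩ := Nat.exists_eq_add_of_le' ht₁
  have hgraded := (hasLeadingTerm_hilbertFunction_succ_iff hk).mp
    (hasLeadingTerm_hilbertFunction hk ht)
  simpa only [add_eq_right, Nat.add_sub_cancel] using hgraded.add_const _

theorem irreducibleMultiplicity_le (hI : I ≤ maximalIdeal R)
    (hk : maximalIdeal R ^ k • (⊤ : Submodule R M) ≤ I • ⊤)
    (ht : Module.supportDim R M = t) :
    irreducibleMultiplicity M I t ≤ hilbertMultiplicity M I t + if t = 1 then
      ((Module.length R (moduleColon (⊥ : Submodule R M) (maximalIdeal R))).toNat : ℤ) else 0 := by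
  have hirr := hasLeadingTerm_irreducibilityFunction hI hk ht
  obtain rfl | ht₁ := t.eq_zero_or_pos
  · rw [if_neg zero_ne_one, add_zero]
    exact hirr.le (hasLeadingTerm_hilbertFunction hk ht) <| Eventually.of_forall fun n =>
      Nat.cast_le.mpr (ENat.toNat_le_toNat (irreducibilityFunction_le_hilbertFunction n)
        (hilbertFunction_ne_top hk n))
  · refine hirr.le (hasLeadingTerm_gradedLength_add_length hk ht ht₁) ?_
    filter_upwards [intValues_irreducibilityFunction_eventuallyEq (M := M) hI] with n hn
    rw [hn]
    exact add_le_add_left (intValues_gradedSocleLength_le hk n) _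

theorem irreducibleMultiplicity_eq (hI : I ≤ maximalIdeal R)
    (hk : maximalIdeal R ^ k • (⊤ : Submodule R M) ≤ I • ⊤)
    (ht : Module.supportDim R M = t) (ht₁ : 1 ≤ t) {m : ℕ}
    (hm : maximalIdeal R • (I ^ m • ⊤ : Submodule R M) ≤ I ^ (m + 1) • ⊤) :
    irreducibleMultiplicity M I t = hilbertMultiplicity M I t + if t = 1 then
      ((Module.length R (moduleColon (⊥ : Submodule R M) (maximalIdeal R))).toNat : ℤ) else 0 := by
  refine ((hasLeadingTerm_irreducibilityFunction hI hk ht).congr ?_).unique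
    (hasLeadingTerm_gradedLength_add_length hk ht ht₁)
  filter_upwards [intValues_irreducibilityFunction_eventuallyEq (M := M) hI,
    eventually_ge_atTop m] with n hn hmn
  rw [hn, intValues, intValues, gradedSocleLength, gradedSocle_eq_of_smul_le hm hmn, gradedLength]

end Irreducibility

/-- The condition `hk` means that `M / I M` has finite length. -/
theorem theorem1p1_general {R M : Type*} [CommRing R] [IsLocalRing R] [IsNoetherianRing R]
    [AddCommGroup M] [Module R M] [Module.Finite R M]
    (I : Ideal R) (hI : I ≤ maximalIdeal R)
    {k : ℕ} (hk : maximalIdeal R ^ k • (⊤ : Submodule R M) ≤ I • ⊤)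
    (t : ℕ) (ht : Module.supportDim R M = (t : WithBot ℕ∞)) :
    (∃! e : Fin (t + 1) → ℤ, IsBinomialCoefficients (hilbertFunction M I) t e) ∧
    (∃! f : Fin (t - 1 + 1) → ℤ,
      IsBinomialCoefficients (irreducibilityFunction M I) (t - 1) f) ∧
    Module.length R (moduleColon (⊥ : Submodule R M) (maximalIdeal R)) ≠ ⊤ ∧
    (t ≠ 1 → irreducibleMultiplicity M I t ≤ hilbertMultiplicity M I t) ∧
    (t = 1 → irreducibleMultiplicity M I t ≤ hilbertMultiplicity M I t +
      ((Module.length R (moduleColon (⊥ : Submodule R M) (maximalIdeal R))).toNat : ℤ)) ∧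
    (1 ≤ t →
      (∃ n : ℕ, maximalIdeal R =
        (I ^ (n + 1) • ⊤ : Submodule R M).colon
          ((I ^ n • ⊤ : Submodule R M) : Set M)) →
      (t ≠ 1 → irreducibleMultiplicity M I t = hilbertMultiplicity M I t) ∧
      (t = 1 → irreducibleMultiplicity M I t = hilbertMultiplicity M I t +
        ((Module.length R (moduleColon (⊥ : Submodule R M) (maximalIdeal R))).toNat : ℤ))) := by
  have hle := irreducibleMultiplicity_le hI hk ht
  refine ⟨?_, ?_, length_moduleColon_bot_ne_top, fun h => ?_, fun h => ?_, fun ht₁ ⟨m, hm⟩ => ?_⟩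
  · exact (hasLeadingTerm_hilbertFunction hk ht).existsUnique_isBinomialCoefficients
      (Eventually.of_forall (hilbertFunction_ne_top hk))
  · exact (hasLeadingTerm_irreducibilityFunction hI hk ht).existsUnique_isBinomialCoefficients
      (Eventually.of_forall irreducibilityFunction_ne_top)
  · rwa [if_neg h, add_zero] at hle
  · rwa [if_pos h] at hle
  · have hsmul : maximalIdeal R • (I ^ m • ⊤ : Submodule R M) ≤ I ^ (m + 1) • ⊤ :=
      Submodule.smul_le.mpr fun a ha x hx => Submodule.mem_colon.mp (hm.le ha) x hx
    have heq := irreducibleMultiplicity_eq hI hk ht ht₁ hsmul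
    refine ⟨fun h => ?_, fun h => ?_⟩
    · rwa [if_neg h, add_zero] at heq
    · rwa [if_pos h] at heq

/-- `(R, 𝔪)` is a Noetherian local ring, `I` an `𝔪`-primary ideal (that is, one with radical `𝔪`)
and `M` a finitely generated `R`-module of dimension `t`. The first three conclusions say that the
quantities in the comparison are well defined. -/
theorem theorem1p1 {R M : Type*} [CommRing R] [IsLocalRing R] [IsNoetherianRing R]
    [AddCommGroup M] [Module R M] [Module.Finite R M]
    (I : Ideal R) (hI : I.radical = maximalIdeal R)
    (t : ℕ) (ht : Module.supportDim R M = (t : WithBot ℕ∞)) :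
    (∃! e : Fin (t + 1) → ℤ, IsBinomialCoefficients (hilbertFunction M I) t e) ∧
    (∃! f : Fin (t - 1 + 1) → ℤ,
      IsBinomialCoefficients (irreducibilityFunction M I) (t - 1) f) ∧
    Module.length R (moduleColon (⊥ : Submodule R M) (maximalIdeal R)) ≠ ⊤ ∧
    (t ≠ 1 → irreducibleMultiplicity M I t ≤ hilbertMultiplicity M I t) ∧
    (t = 1 → irreducibleMultiplicity M I t ≤ hilbertMultiplicity M I t +
      ((Module.length R (moduleColon (⊥ : Submodule R M) (maximalIdeal R))).toNat : ℤ)) ∧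
    (1 ≤ t →
      (∃ n : ℕ, maximalIdeal R =
        (I ^ (n + 1) • ⊤ : Submodule R M).colon
          ((I ^ n • ⊤ : Submodule R M) : Set M)) →
      (t ≠ 1 → irreducibleMultiplicity M I t = hilbertMultiplicity M I t) ∧
      (t = 1 → irreducibleMultiplicity M I t = hilbertMultiplicity M I t +
        ((Module.length R (moduleColon (⊥ : Submodule R M) (maximalIdeal R))).toNat : ℤ))) := by
  obtain ⟨k, hk⟩ := Ideal.exists_pow_le_of_le_radical_of_fg hI.ge (IsNoetherian.noetherian _)
  exact theorem1p1_general I (hI ▸ Ideal.le_radical) (Submodule.smul_mono_left hk) t ht
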